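/- Let $U$ be an arbitrary set, let $(S,\mathcal S,P)$ be a probability space, and let $X=\{X_u\}_{u\in U}$ be a real Gaussian process on it (every finite subfamily is jointly Gaussian, possibly degenerate; the mean is arbitrary), with covariance kernel $$K(u,v)=\mathbb E\big[(X_u-\mathbb E X_u)(X_v-\mathbb E X_v)\big],\qquad u,v\in U.$$ Let $\Omega\subset U\times U$ be an undirected graph on $U$, that is, $(u,u)\in\Omega$ for every $u\in U$, and $(u,v)\in\Omega$ if and only if $(v,u)\in\Omega$. A path from $u$ to $v$ is a finite sequence $w_0=u,w_1,\dots,w_{n+1}=v$ in $U$ $(n\ge 0)$ with $(w_k,w_{k+1})\in\Omega$ for $0\le k\le n$. A set $W\subset U$ separates $u$ and $v$ in $\Omega$ if every path from $u$ to $v$ passes through $W$, that is, has some vertex $w_k\in W$, $0\le k\le n+1$ (in particular, $W=\varnothing$ separates $u$ and $v$ if no path joins them). For $W\subset U$ let $X_W=\{X_w\}_{w\in W}$, let $K_W=K|_{W\times W}$, and let $\mathcal H(K_W)$ be the reproducing kernel Hilbert space of functions on $W$ with kernel $K_W$; the restrictions $K(u,\cdot)|_W$ and $K(\cdot,v)|_W$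 belong to $\mathcal H(K_W)$ for all $u,v\in U$. Then the following two statements are equivalent: (A) (global Markov property) for all $u,v\in U$ and all $W\subset U$ separating $u$ and $v$ in $\Omega$, the random variables $X_u$ and $X_v$ are conditionally independent given $\sigma(X_W)$, the $\sigma$-algebra generated by $X_W$; (B) (separation equation) for all $u,v\in U$ and all $W\subset U$ separating $u$ and $v$ in $\Omega$, $$K(u,v)=\big\langle K(u,\cdot)|_W,\;K(\cdot,v)|_W\big\rangle_{\mathcal H(K_W)}.$$ -/

import Mathlib

open MeasureTheory ProbabilityTheory
open scoped InnerProductSpace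

/-- An undirected graph on the vertex set `U`: a symmetric edge set `Ω ⊆ U × U` which, by
convention, contains every loop `(u, u)`. -/
structure EdgeGraph (U : Type*) where
  edges : Set (U × U)
  refl : ∀ u, (u, u) ∈ edges
  symm : ∀ u v, (u, v) ∈ edges ↔ (v, u) ∈ edges

namespace EdgeGraph

variable {U : Type*}

/-- A path from `u` to `v` is a finite sequence `w 0 = u, w 1, …, w (n + 1) = v` of vertices
such that consecutive vertices are adjacent. -/
structure IsPath (Ω : EdgeGraph U) (u v : U) {n : ℕ} (w : Fin (n + 2) → U) : Prop where
  source : w 0 = u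
  target : w (Fin.last (n + 1)) = v
  adj : ∀ k : Fin (n + 1), (w k.castSucc, w k.succ) ∈ Ω.edges

/-- `W` separates `u` and `v` in `Ω` if every path from `u` to `v` passes through `W`. -/
def Separates (Ω : EdgeGraph U) (W : Set U) (u v : U) : Prop :=
  ∀ (n : ℕ) (w : Fin (n + 2) → U), Ω.IsPath u v w → ∃ k, w k ∈ W

end EdgeGraph

/-- A reproducing kernel on `U`: a real, symmetric, positive-definite function on `U × U`. -/
structure ReproducingKernel (U : Type*) where
  toFun : U → U → ℝ
  symm : ∀ u v, toFun u v = toFun v u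
  nonneg : ∀ (n : ℕ) (α : Fin n → ℝ) (x : Fin n → U),
    0 ≤ ∑ i, ∑ j, α i * α j * toFun (x i) (x j)

namespace ReproducingKernel

variable {U : Type*}

instance : CoeFun (ReproducingKernel U) (fun _ => U → U → ℝ) := ⟨toFun⟩

/-- The restriction `K_W` of the kernel `K` to `W × W`. -/
def restrict (K : ReproducingKernel U) (W : Set U) : ReproducingKernel W where
  toFun u v := K u v
  symm u v := K.symm u v
  nonneg n α x := K.nonneg n α (fun i => (x i : U))

/-- The kernel with its values regarded as (scalar) operators on `ℝ`. -/
noncomputable def toMatrix (K : ReproducingKernel U) : Matrix U U (ℝ →L[ℝ] ℝ) :=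
  Matrix.of fun u v => K u v • ContinuousLinearMap.id ℝ ℝ

lemma toMatrix_apply (K : ReproducingKernel U) (u v : U) (a : ℝ) :
    K.toMatrix u v a = K u v * a := by
  simp [toMatrix]

lemma sum_nonneg (K : ReproducingKernel U) (s : Finset U) (a : U → ℝ) :
    0 ≤ ∑ u ∈ s, ∑ v ∈ s, a u * a v * K u v := by
  have h := K.nonneg s.card (fun i => a (s.equivFin.symm i)) (fun i => s.equivFin.symm i)
  have key : ∀ f : U → ℝ, ∑ u ∈ s, f u = ∑ i, f (s.equivFin.symm i) := by
    intro f
    rw [← Finset.sum_coe_sort s f]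
    exact (Equiv.sum_comp s.equivFin.symm (fun u : s => f u)).symm
  rw [key]
  simpa only [key] using h

lemma posSemidef_toMatrix (K : ReproducingKernel U) : K.toMatrix.PosSemidef := by
  have tfae : K.toMatrix.PosSemidef ↔ K.toMatrix.IsHermitian ∧ ∀ a : U →₀ ℝ,
      0 ≤ RCLike.re (a.sum fun x w => a.sum fun x' w' => ⟪K.toMatrix x' x w, w'⟫_ℝ) :=
    RKHS.posSemidef_tfae.out 0 2
  refine tfae.mpr ⟨?_, fun a => ?_⟩
  · ext u v
    have h1 : star (ContinuousLinearMap.id ℝ ℝ) = ContinuousLinearMap.id ℝ ℝ :=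
      star_one (ℝ →L[ℝ] ℝ)
    simp [toMatrix, h1, K.symm u v]
  · have h := K.sum_nonneg a.support a
    simp only [Finsupp.sum, toMatrix_apply]
    refine h.trans_eq ?_
    simp only [RCLike.re_to_real]
    refine Finset.sum_congr rfl fun u _ => Finset.sum_congr rfl fun v _ => ?_
    rw [K.symm u v]
    simp
    ring

instance (K : ReproducingKernel U) : Fact K.toMatrix.PosSemidef := ⟨K.posSemidef_toMatrix⟩

/-- The reproducing kernel Hilbert space `H(K)` of `K`; its elements coerce to functions
`U → ℝ`. -/
abbrev Space (K : ReproducingKernel U) := RKHS.OfKernel K.toMatrix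

lemma kernel_space (K : ReproducingKernel U) : RKHS.kernel K.Space = K.toMatrix :=
  RKHS.OfKernel.kernel_ofKernel

/-- The element `K(u, ·)` of `H(K)`. -/
noncomputable def point (K : ReproducingKernel U) (u : U) : K.Space := RKHS.kerFun K.Space u 1

lemma inner_point (K : ReproducingKernel U) (f : K.Space) (u : U) :
    ⟪f, K.point u⟫_ℝ = f u := by
  simp [point]

lemma point_apply (K : ReproducingKernel U) (u v : U) : K.point u v = K u v := by
  rw [point, RKHS.kerFun_apply, kernel_space, toMatrix_apply, mul_one, K.symm]

lemma dense_points (K : ReproducingKernel U) :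
    DenseRange (Finsupp.linearCombination ℝ K.point) := by
  have h := RKHS.kerFun_dense K.Space
  have h2 : Submodule.span ℝ {RKHS.kerFun K.Space x v | (x) (v)} ≤
      LinearMap.range (Finsupp.linearCombination ℝ K.point) := by
    rw [Submodule.span_le]
    rintro _ ⟨x, v, rfl⟩
    refine ⟨Finsupp.single x v, ?_⟩
    rw [Finsupp.linearCombination_single, point, ← map_smul]
    simp
  have h3 := Submodule.topologicalClosure_mono h2
  rw [h, top_le_iff] at h3
  have h4 := (Submodule.dense_iff_topologicalClosure_eq_top).mpr h3
  rwa [LinearMap.coe_range] at h4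

/-- The restriction to `W` of the kernel function `K(u, ·)` belongs to `H(K_W)`. -/
lemma exists_eq_section (K : ReproducingKernel U) (W : Set U) (u : U) :
    ∃ f : (K.restrict W).Space, ∀ w : W, f w = K u w := by
  set e := Finsupp.linearCombination ℝ (K.restrict W).point with he
  set T := Finsupp.linearCombination ℝ (fun w : W => K.point w) with hT
  have hnorm : ∀ a, ‖T a‖ = ‖e a‖ := by
    intro a
    have h : ⟪T a, T a⟫_ℝ = ⟪e a, e a⟫_ℝ := by
      simp only [he, hT, Finsupp.linearCombination_apply, Finsupp.sum_inner, Finsupp.inner_sum,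
        inner_smul_left, inner_smul_right, inner_point, point_apply]
      rfl
    rw [real_inner_self_eq_norm_sq, real_inner_self_eq_norm_sq] at h
    exact (sq_eq_sq₀ (norm_nonneg _) (norm_nonneg _)).mp h
  have hb : ∃ C, ∀ a, ‖T a‖ ≤ C * ‖e a‖ := ⟨1, fun a => by rw [hnorm, one_mul]⟩
  refine ⟨(T.extendOfNorm e).adjoint (K.point u), fun w => ?_⟩
  have h1 : T.extendOfNorm e ((K.restrict W).point w) = K.point w := by
    have := LinearMap.extendOfNorm_eq (f := T) (e := e) (dense_points _) hb (Finsupp.single w 1)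
    simpa [he, hT] using this
  rw [← inner_point, ContinuousLinearMap.adjoint_inner_left, h1, inner_point, point_apply]

/-- The function `K(u, ·)|_W`, as an element of `H(K_W)`. -/
noncomputable def sectionOn (K : ReproducingKernel U) (W : Set U) (u : U) :
    (K.restrict W).Space :=
  (K.exists_eq_section W u).choose

lemma sectionOn_apply (K : ReproducingKernel U) (W : Set U) (u : U) (w : W) :
    K.sectionOn W u w = K u w :=
  (K.exists_eq_section W u).choose_spec w

end ReproducingKernel

section Gaussian

variable {U S : Type*} {mS : MeasurableSpace S}

/-- The covariance kernel `K(u, v) = E[(X_u - E X_u)(X_v - E X_v)]` of a Gaussian process. -/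
noncomputable def covKernel (X : U → S → ℝ) (P : Measure S) (hX : IsGaussianProcess X P) :
    ReproducingKernel U where
  toFun u v := ∫ s, (X u s - ∫ s', X u s' ∂P) * (X v s - ∫ s', X v s' ∂P) ∂P
  symm u v := by simp only [mul_comm]
  nonneg n α x := by
    have := hX.isProbabilityMeasure
    have hL : ∀ i, MemLp (fun s => α i * X (x i) s) 2 P := fun i =>
      (hX.hasGaussianLaw_eval (x i)).memLp_two.const_mul (α i)
    have h := covariance_fun_sum_fun_sum hL hL
    rw [covariance_self (Finset.aemeasurable_fun_sum _ fun i _ => (hL i).aemeasurable)] at h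
    simp only [covariance_const_mul_left, covariance_const_mul_right] at h
    have h0 := variance_nonneg (fun s => ∑ i, α i * X (x i) s) P
    rw [h] at h0
    refine h0.trans_eq (Finset.sum_congr rfl fun i _ => Finset.sum_congr rfl fun j _ => ?_)
    rw [covariance]
    ring

/-- Conditional independence `Y ⫫ Z | m` of two real random variables given a σ-algebra `m`, on an
arbitrary probability space. -/
def CondIndepGiven {S : Type*} (m : MeasurableSpace S) {mS : MeasurableSpace S} (Y Z : S → ℝ)
    (P : Measure S) : Prop :=
  ∀ A B : Set ℝ, MeasurableSet A → MeasurableSet B →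
    P[(Y ⁻¹' A ∩ Z ⁻¹' B).indicator (fun _ => (1 : ℝ)) | m] =ᵐ[P]
      fun s => (P[(Y ⁻¹' A).indicator (fun _ => (1 : ℝ)) | m]) s *
        (P[(Z ⁻¹' B).indicator (fun _ => (1 : ℝ)) | m]) s

/-- The σ-algebra generated by `X_W = {X_w : w ∈ W}`. -/
abbrev sigmaOn (X : U → S → ℝ) (W : Set U) : MeasurableSpace S :=
  MeasurableSpace.comap (fun s (w : W) => X w s) inferInstance

/-- The global Markov property: `X_u ⫫ X_v | X_W` whenever `W` separates `u` and `v`. -/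
def GlobalMarkov (X : U → S → ℝ) (P : Measure S) (Ω : EdgeGraph U) : Prop :=
  ∀ (u v : U) (W : Set U), Ω.Separates W u v → CondIndepGiven (sigmaOn X W) (X u) (X v) P

end Gaussian

/-- The separation equation `K(u, v) = ⟨K(u, ·), K(·, v)⟩` in `H(K_W)`. As `K` is symmetric,
`K.sectionOn W v` is also the function `K(·, v)|_W`. -/
def SeparationEquation {U : Type*} (K : ReproducingKernel U) (W : Set U) (u v : U) : Prop :=
  K u v = ⟪K.sectionOn W u, K.sectionOn W v⟫_ℝ

/-! The graph only selects triples `(u, v, W)`; the equivalence holds for each triple separately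
(`condIndepGiven_iff_separationEquation`). In `L²` the closed span of the centred `X_w`, `w ∈ W`, is
an isometric copy of `H(K_W)`, and `K(u, ·)|_W` corresponds to the projection of the centred `X_u`
onto it. The projection residuals therefore have covariance `K(u, v) - ⟨K(u, ·), K(·, v)⟩`
(`exists_residual`). An `L²` limit of Gaussian variables is Gaussian (`isClosed_hasGaussianLaw`), so
the residuals are jointly Gaussian with `X_W`; being uncorrelated with it, they are independent of
it (`exists_add_indep_residual`). Conditioning on `X_W` then freezes the projections, and
conditional independence becomes independence of the two residuals (`condIndepGiven_add_iff`). For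
Gaussian residuals this means zero covariance, which is the separation equation. -/

namespace ReproducingKernel

/-! ### Projection in Hilbert space through the RKHS -/

variable {U E : Type*} [NormedAddCommGroup E] [InnerProductSpace ℝ E]

/-- A family of vectors with Gram matrix `K` embeds `H(K_W)` isometrically. -/
lemma exists_isometry [CompleteSpace E] (K : ReproducingKernel U) (Y : U → E) (hY : ∀ u v, ⟪Y u, Y v⟫_ℝ = K u v)
    (W : Set U) :
    ∃ J : (K.restrict W).Space →ₗᵢ[ℝ] E, ∀ w : W, J ((K.restrict W).point w) = Y w := by
  set e := Finsupp.linearCombination ℝ (K.restrict W).point with he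
  set T := Finsupp.linearCombination ℝ (fun w : W => Y w) with hT
  have hnorm : ∀ a, ‖T a‖ = ‖e a‖ := by
    intro a
    have h : ⟪T a, T a⟫_ℝ = ⟪e a, e a⟫_ℝ := by
      simp only [he, hT, Finsupp.linearCombination_apply, Finsupp.sum_inner, Finsupp.inner_sum,
        inner_smul_left, inner_smul_right, inner_point, point_apply, hY]
      rfl
    rw [real_inner_self_eq_norm_sq, real_inner_self_eq_norm_sq] at h
    exact (sq_eq_sq₀ (norm_nonneg _) (norm_nonneg _)).mp h
  have hb : ∃ C, ∀ a, ‖T a‖ ≤ C * ‖e a‖ := ⟨1, fun a => by rw [hnorm, one_mul]⟩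
  have hext := LinearMap.extendOfNorm_eq (f := T) (e := e) (dense_points _) hb
  refine ⟨⟨(T.extendOfNorm e).toLinearMap, fun f => ?_⟩, fun w => ?_⟩
  · refine (dense_points (K.restrict W)).induction_on f
      (isClosed_eq (by fun_prop) (by fun_prop)) fun a => ?_
    simp only [ContinuousLinearMap.coe_coe]
    rw [hext, hnorm]
  · simpa [he, hT] using hext (Finsupp.single w 1)

/-- Kernel functions span a dense subspace. With suitable choices of `N`, projections inherit
orthogonality, measurability and Gaussianity from the vectors indexed by `W`. -/
lemma map_mem_of_point_mem {K : ReproducingKernel U} (J : K.Space →ₗᵢ[ℝ] E) {N : Submodule ℝ E}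
    (hN : IsClosed (N : Set E)) (h : ∀ u, J (K.point u) ∈ N) (f : K.Space) : J f ∈ N := by
  refine (dense_points K).induction_on f (hN.preimage J.continuous) fun a => ?_
  rw [Finsupp.linearCombination_apply, Finsupp.sum, map_sum]
  exact N.sum_mem fun u _ => by rw [map_smul]; exact N.smul_mem _ (h u)

/-- Subtracting from each vector of a family with Gram matrix `K` its projection to the span of the
vectors indexed by `W` leaves residuals with Gram matrix `K(u, v) - ⟨K(u, ·), K(·, v)⟩`. -/
lemma exists_residual [CompleteSpace E] (K : ReproducingKernel U) (Y : U → E) (hY : ∀ u v, ⟪Y u, Y v⟫_ℝ = K u v)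
    (W : Set U) :
    ∃ p : U → E,
      (∀ (N : Submodule ℝ E), IsClosed (N : Set E) → (∀ w ∈ W, Y w ∈ N) → ∀ u, p u ∈ N) ∧
      (∀ u, ∀ w ∈ W, ⟪Y u - p u, Y w⟫_ℝ = 0) ∧
      ∀ u v, ⟪Y u - p u, Y v - p v⟫_ℝ = K u v - ⟪K.sectionOn W u, K.sectionOn W v⟫_ℝ := by
  obtain ⟨J, hJ⟩ := K.exists_isometry Y hY W
  have hmem : ∀ (N : Submodule ℝ E), IsClosed (N : Set E) → (∀ w ∈ W, Y w ∈ N) →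
      ∀ f, J f ∈ N := fun N hN h f =>
    map_mem_of_point_mem J hN (fun w => by rw [hJ]; exact h w w.2) f
  have horth : ∀ u, ∀ w ∈ W, ⟪Y u - J (K.sectionOn W u), Y w⟫_ℝ = 0 := fun u w hw => by
    rw [inner_sub_left, hY, ← hJ ⟨w, hw⟩, J.inner_map_map, inner_point, sectionOn_apply, sub_self]
  -- Here `N` is the orthogonal complement of the residual itself.
  have horth' : ∀ u f, ⟪Y u - J (K.sectionOn W u), J f⟫_ℝ = 0 := fun u f =>
    (Submodule.mem_orthogonal_singleton_iff_inner_right).mp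
      (hmem _ (Submodule.isClosed_orthogonal _)
        (fun w hw => Submodule.mem_orthogonal_singleton_iff_inner_right.mpr (horth u w hw)) f)
  refine ⟨fun u => J (K.sectionOn W u), fun N hN h u => hmem N hN h _, horth, fun u v => ?_⟩
  have h := horth' v (K.sectionOn W u)
  rw [inner_sub_right, horth', sub_zero, inner_sub_left, hY]
  rw [inner_sub_left, J.inner_map_map, real_inner_comm] at h
  rw [real_inner_comm (K.sectionOn W u)] at h
  linarith

end ReproducingKernel

/-! ### Gaussian variables in `L²` -/

section L2

variable {S : Type*} {mS : MeasurableSpace S} {P : Measure S}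

lemma MeasureTheory.L2.integral_mul_eq_inner (f g : Lp ℝ 2 P) :
    ∫ s, f s * g s ∂P = ⟪f, g⟫_ℝ := by
  rw [L2.inner_def]
  refine integral_congr_ae (ae_of_all _ fun s => ?_)
  simp [mul_comm]

/-- A linear functional of finitely many `F t` is again an element of `M`, so it has a Gaussian law;
this is joint Gaussianity. -/
lemma isGaussianProcess_of_forall_mem {T : Type*} {M : Submodule ℝ (Lp ℝ 2 P)}
    (hM : ∀ f ∈ M, HasGaussianLaw f P) (F : T → Lp ℝ 2 P) (hF : ∀ t, F t ∈ M) :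
    IsGaussianProcess (fun t => (F t : S → ℝ)) P where
  hasGaussianLaw I := by
    classical
    have hm : AEMeasurable (fun s => I.restrict fun t => F t s) P :=
      aemeasurable_pi_lambda _ fun t => (Lp.aestronglyMeasurable (F t)).aemeasurable
    refine ⟨isGaussian_of_isGaussian_map fun L => ?_⟩
    rw [AEMeasurable.map_map_of_aemeasurable (by fun_prop) hm]
    refine HasGaussianLaw.isGaussian_map (HasGaussianLaw.congr (hM _ (M.sum_mem fun (i : I)
      (_ : i ∈ Finset.univ) => M.smul_mem (L (Pi.single i 1)) (hF i))) ?_)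
    have h1 : ∀ᵐ s ∂P, ∀ i : I, (L (Pi.single i 1) • F i : Lp ℝ 2 P) s =
        L (Pi.single i 1) * F i s := ae_all_iff.mpr fun i => by
      filter_upwards [Lp.coeFn_smul (L (Pi.single i 1)) (F i)] with s hs
      simp [hs]
    filter_upwards [Lp.coeFn_finsetSum Finset.univ
      (fun i : I => L (Pi.single i 1) • F i), h1] with s hs h1
    rw [hs, Finset.sum_apply, Function.comp_apply, ← ContinuousLinearMap.coe_coe,
      LinearMap.pi_apply_eq_sum_univ L.toLinearMap]
    refine Finset.sum_congr rfl fun i _ => ?_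
    have h2 : (fun j => if i = j then 1 else 0 : I → ℝ) = Pi.single i 1 := by
      ext j
      simp [Pi.single_apply, eq_comm]
    rw [h2]
    exact (h1 i).trans (mul_comm _ _)

variable [IsProbabilityMeasure P]

lemma integral_eq_inner_const (f : Lp ℝ 2 P) :
    ∫ s, f s ∂P = ⟪Lp.const 2 P (1 : ℝ), f⟫_ℝ := by
  rw [← L2.integral_mul_eq_inner]
  refine integral_congr_ae ?_
  filter_upwards [Lp.coeFn_const (p := 2) (μ := P) (1 : ℝ)] with s hs
  rw [hs, Function.const_apply, one_mul]

lemma integral_abs_sub_le_norm (f g : Lp ℝ 2 P) : ∫ s, |f s - g s| ∂P ≤ ‖f - g‖ := by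
  have hm := (Lp.memLp (f - g))
  have h : ∫ s, |f s - g s| ∂P = ∫ s, ‖(f - g : Lp ℝ 2 P) s‖ ∂P := by
    refine integral_congr_ae ?_
    filter_upwards [Lp.coeFn_sub f g] with s hs
    rw [hs, Pi.sub_apply, Real.norm_eq_abs]
  rw [h, integral_norm_eq_lintegral_enorm hm.1, Lp.norm_def, ← eLpNorm_one_eq_lintegral_enorm]
  exact ENNReal.toReal_mono hm.2.ne (eLpNorm_le_eLpNorm_of_exponent_le (by norm_num) hm.1)

/-- Since `|exp(ia) - exp(ib)| ≤ |a - b|`, the map is `|t|`-Lipschitz for the `L¹` distance, which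
the `L²` distance dominates. -/
lemma continuous_charFun_map_Lp (t : ℝ) :
    Continuous fun f : Lp ℝ 2 P => charFun (P.map f) t := by
  have hint : ∀ f : Lp ℝ 2 P, Integrable (fun s => Complex.exp (t * f s * Complex.I)) P := by
    intro f
    refine Integrable.of_bound (C := 1) ?_ (ae_of_all _ fun s => ?_)
    · have := (Lp.aestronglyMeasurable f).aemeasurable
      exact AEMeasurable.aestronglyMeasurable (by fun_prop)
    · rw [← Complex.ofReal_mul, Complex.norm_exp_ofReal_mul_I]
  have heq : ∀ f : Lp ℝ 2 P,
      charFun (P.map f) t = ∫ s, Complex.exp (t * f s * Complex.I) ∂P := by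
    intro f
    rw [charFun_apply_real, integral_map (Lp.aestronglyMeasurable f).aemeasurable]
    exact Continuous.aestronglyMeasurable (by fun_prop)
  have hlip : ∀ f g : Lp ℝ 2 P,
      dist (charFun (P.map f) t) (charFun (P.map g) t) ≤ ‖t‖₊ * dist f g := by
    intro f g
    rw [heq, heq, dist_eq_norm, dist_eq_norm, ← integral_sub (hint f) (hint g), coe_nnnorm]
    have hb : ∀ s, ‖Complex.exp (t * f s * Complex.I) - Complex.exp (t * g s * Complex.I)‖ ≤
        ‖t‖ * |f s - g s| := by
      intro s
      have h1 : Complex.exp (t * f s * Complex.I) - Complex.exp (t * g s * Complex.I) =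
          Complex.exp ((t * g s : ℝ) * Complex.I) *
            (Complex.exp (Complex.I * (t * (f s - g s) : ℝ)) - 1) := by
        rw [mul_sub, ← Complex.exp_add]
        push_cast
        ring_nf
      rw [h1, norm_mul, Complex.norm_exp_ofReal_mul_I, one_mul]
      refine (Real.norm_exp_I_mul_ofReal_sub_one_le).trans_eq ?_
      rw [norm_mul, Real.norm_eq_abs (f s - g s)]
    have hi : Integrable (fun s => |f s - g s|) P :=
      (((Lp.memLp f).sub (Lp.memLp g)).integrable one_le_two).abs
    calc _ ≤ ∫ s, ‖t‖ * |f s - g s| ∂P :=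
          norm_integral_le_of_norm_le (hi.const_mul _) (ae_of_all _ hb)
      _ ≤ _ := by
          rw [integral_const_mul]
          exact mul_le_mul_of_nonneg_left (integral_abs_sub_le_norm f g) (norm_nonneg _)
  exact (LipschitzWith.of_dist_le_mul hlip).continuous

/-- Gaussian random variables form a closed subset of `L²`. -/
lemma isClosed_hasGaussianLaw : IsClosed {f : Lp ℝ 2 P | HasGaussianLaw f P} := by
  -- For each `t`, both sides of the characteristic function identity are continuous in `f`, the
  -- variance being `‖f‖² - (∫ f)²`.
  have h : {f : Lp ℝ 2 P | HasGaussianLaw f P} = ⋂ t : ℝ, {f : Lp ℝ 2 P |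
      charFun (P.map f) t = Complex.exp ((t * ∫ s, f s ∂P : ℝ) * Complex.I -
        ((t ^ 2 * (‖f‖ ^ 2 - (∫ s, f s ∂P) ^ 2) : ℝ) : ℂ) / 2)} := by
    ext f
    simp only [Set.mem_ofPred_eq, Set.mem_iInter,
      hasGaussianLaw_iff_charFun_map_eq (Lp.aestronglyMeasurable f).aemeasurable]
    refine forall_congr' fun t => ?_
    have h1 : Var[f; P] = ‖f‖ ^ 2 - (∫ s, f s ∂P) ^ 2 := by
      rw [variance_eq_sub (Lp.memLp f), ← real_inner_self_eq_norm_sq, ← L2.integral_mul_eq_inner]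
      simp [pow_two]
    have h2 : ∀ s, ⟪t, f s⟫_ℝ = t * f s := fun s => by simp [mul_comm]
    simp only [h2]
    rw [integral_const_mul, variance_const_mul, h1]
  rw [h]
  refine isClosed_iInter fun t => isClosed_eq (continuous_charFun_map_Lp t) ?_
  simp only [integral_eq_inner_const]
  fun_prop

end L2

/-! ### Conditioning with an independent remainder -/

section Freezing

variable {S F G : Type*} {m mS : MeasurableSpace S} [MeasurableSpace F] [MeasurableSpace G]
  {P : Measure S} [IsProbabilityMeasure P]

lemma measure_inter_mem_eq_setLIntegral (hm : m ≤ mS) {ξ : S → F} {ρ : S → G}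
    (hξ : Measurable[m] ξ) (hρ : Measurable ρ)
    (hind : Indep m (MeasurableSpace.comap ρ inferInstance) P) {C : Set (F × G)}
    (hC : MeasurableSet C) {t : Set S} (ht : MeasurableSet[m] t) :
    P (t ∩ {s | (ξ s, ρ s) ∈ C}) = ∫⁻ s in t, P.map ρ (Prod.mk (ξ s) ⁻¹' C) ∂P := by
  -- Recording membership in `t` as a random variable turns the event into one about `(η, ρ)`, whose
  -- law is a product, so Tonelli applies.
  let η : S → Prop × F := fun s => (s ∈ t, ξ s)
  have hη : Measurable[m] η := (@measurable_mem _ t m |>.mpr ht).prodMk hξ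
  have hη' : Measurable η := hη.mono hm le_rfl
  have hi : IndepFun η ρ P :=
    (IndepFun_iff_Indep _ _ _).mpr (indep_of_indep_of_le_left hind hη.comap_le)
  have hD : MeasurableSet {x : (Prop × F) × G | x.1.1 ∧ (x.1.2, x.2) ∈ C} :=
    (measurableSet_setOfPred.mpr (by fun_prop)).inter
      ((show Measurable fun x : (Prop × F) × G => (x.1.2, x.2) by fun_prop) hC)
  have h1 : t ∩ {s | (ξ s, ρ s) ∈ C} =
      (fun s => (η s, ρ s)) ⁻¹' {x : (Prop × F) × G | x.1.1 ∧ (x.1.2, x.2) ∈ C} := rfl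
  rw [h1, ← Measure.map_apply (hη'.prodMk hρ) hD,
    (indepFun_iff_map_prod_eq_prod_map_map hη'.aemeasurable hρ.aemeasurable).mp hi]
  have := P.isProbabilityMeasure_map hρ.aemeasurable
  rw [Measure.prod_apply hD, lintegral_map (measurable_measure_prodMk_left hD) hη',
    ← lintegral_indicator (hm _ ht)]
  refine lintegral_congr fun s => ?_
  by_cases hs : s ∈ t
  · rw [Set.indicator_of_mem hs]
    congr 1
    ext x
    simp [η, hs]
  · rw [Set.indicator_of_notMem hs, ← measure_empty (μ := P.map ρ)]
    congr 1
    ext x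
    simp [η, hs]

lemma condExp_indicator_mem_of_indep (hm : m ≤ mS) {ξ : S → F} {ρ : S → G}
    (hξ : Measurable[m] ξ) (hρ : Measurable ρ)
    (hind : Indep m (MeasurableSpace.comap ρ inferInstance) P) {C : Set (F × G)}
    (hC : MeasurableSet C) :
    P[{s | (ξ s, ρ s) ∈ C}.indicator (fun _ => (1 : ℝ)) | m] =ᵐ[P]
      fun s => (P.map ρ).real (Prod.mk (ξ s) ⁻¹' C) := by
  have := P.isProbabilityMeasure_map hρ.aemeasurable
  have hE : MeasurableSet {s | (ξ s, ρ s) ∈ C} := ((hξ.mono hm le_rfl).prodMk hρ) hC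
  have hmeas : Measurable[m] fun s => P.map ρ (Prod.mk (ξ s) ⁻¹' C) :=
    (measurable_measure_prodMk_left hC).comp hξ
  have hmeas' : Measurable[m] fun s => (P.map ρ).real (Prod.mk (ξ s) ⁻¹' C) := hmeas.ennreal_toReal
  have hint : Integrable (fun s => (P.map ρ).real (Prod.mk (ξ s) ⁻¹' C)) P :=
    Integrable.of_bound (C := 1) (hmeas'.mono hm le_rfl).aestronglyMeasurable
      (ae_of_all _ fun s => by
        rw [Real.norm_of_nonneg measureReal_nonneg]; exact measureReal_le_one)
  refine (ae_eq_condExp_of_forall_setIntegral_eq hm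
    ((integrable_const 1).indicator hE) (fun t _ _ => hint.integrableOn) (fun t ht _ => ?_)
    hmeas'.stronglyMeasurable.aestronglyMeasurable).symm
  rw [setIntegral_indicator hE, setIntegral_const, smul_eq_mul, mul_one, Measure.real,
    measure_inter_mem_eq_setLIntegral hm hξ hρ hind hC ht]
  exact integral_toReal (hmeas.mono hm le_rfl).aemeasurable
    (ae_of_all _ fun s => measure_lt_top _ _)

lemma indepFun_of_measure_Iic_rat {r q : S → ℝ} (hr : Measurable r) (hq : Measurable q)
    (h : ∀ a b : ℚ, P (r ⁻¹' Set.Iic (a : ℝ) ∩ q ⁻¹' Set.Iic (b : ℝ)) =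
      P (r ⁻¹' Set.Iic (a : ℝ)) * P (q ⁻¹' Set.Iic (b : ℝ))) : IndepFun r q P := by
  have hgen : ∀ f : S → ℝ, MeasurableSpace.comap f inferInstance =
      MeasurableSpace.generateFrom (Set.preimage f '' ⋃ a : ℚ, {Set.Iic (a : ℝ)}) := fun f => by
    rw [← MeasurableSpace.comap_generateFrom, ← Real.borel_eq_generateFrom_Iic_rat,
      (inferInstance : BorelSpace ℝ).measurable_eq]
  have hpi : ∀ f : S → ℝ, IsPiSystem (Set.preimage f '' ⋃ a : ℚ, {Set.Iic (a : ℝ)}) := fun f =>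
    Real.isPiSystem_Iic_rat.comap f
  refine (IndepFun_iff_Indep _ _ _).mpr (IndepSets.indep hr.comap_le hq.comap_le (hpi r) (hpi q)
    (hgen r) (hgen q) ?_)
  rw [IndepSets_iff]
  rintro _ _ ⟨A, hA, rfl⟩ ⟨B, hB, rfl⟩
  simp only [Set.mem_iUnion, Set.mem_singleton_iff] at hA hB
  obtain ⟨a, rfl⟩ := hA
  obtain ⟨b, rfl⟩ := hB
  exact h a b

lemma condIndepGiven_add_iff (hm : m ≤ mS) {g h r q : S → ℝ} (hg : Measurable[m] g)
    (hh : Measurable[m] h) (hr : Measurable r) (hq : Measurable q)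
    (hind : Indep m (MeasurableSpace.comap (fun s => (r s, q s)) inferInstance) P) :
    CondIndepGiven m (fun s => g s + r s) (fun s => h s + q s) P ↔ IndepFun r q P := by
  have hρ := hr.prodMk hq
  have key : ∀ A B : Set ℝ, MeasurableSet A → MeasurableSet B →
      P[(((fun s => g s + r s) ⁻¹' A) ∩ ((fun s => h s + q s) ⁻¹' B)).indicator
        (fun _ => (1 : ℝ)) | m] =ᵐ[P]
      fun s => P.real ((fun s' => g s + r s') ⁻¹' A ∩ (fun s' => h s + q s') ⁻¹' B) := by
    intro A B hA hB
    have hC : MeasurableSet {x : (ℝ × ℝ) × (ℝ × ℝ) | x.1.1 + x.2.1 ∈ A ∧ x.1.2 + x.2.2 ∈ B} :=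
      ((show Measurable fun x : (ℝ × ℝ) × (ℝ × ℝ) => x.1.1 + x.2.1 by fun_prop) hA).inter
        ((show Measurable fun x : (ℝ × ℝ) × (ℝ × ℝ) => x.1.2 + x.2.2 by fun_prop) hB)
    refine (condExp_indicator_mem_of_indep hm (hg.prodMk hh) hρ hind hC).trans
      (ae_of_all _ fun s => ?_)
    simp only [Measure.real]
    rw [Measure.map_apply hρ (measurable_prodMk_left hC)]
    rfl
  have keyA : ∀ A : Set ℝ, MeasurableSet A →
      P[((fun s => g s + r s) ⁻¹' A).indicator (fun _ => (1 : ℝ)) | m] =ᵐ[P]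
      fun s => P.real ((fun s' => g s + r s') ⁻¹' A) := fun A hA => by
    simpa using key A Set.univ hA .univ
  have keyB : ∀ B : Set ℝ, MeasurableSet B →
      P[((fun s => h s + q s) ⁻¹' B).indicator (fun _ => (1 : ℝ)) | m] =ᵐ[P]
      fun s => P.real ((fun s' => h s + q s') ⁻¹' B) := fun B hB => by
    simpa using key Set.univ B .univ hB
  constructor
  · intro H
    -- Rational thresholds leave countably many almost sure identities, so a single `s` satisfies
    -- all of them.
    have hae : ∀ᵐ s ∂P, ∀ a b : ℚ,
        P.real ((fun s' => g s + r s') ⁻¹' Set.Iic (a : ℝ) ∩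
          (fun s' => h s + q s') ⁻¹' Set.Iic (b : ℝ)) =
        P.real ((fun s' => g s + r s') ⁻¹' Set.Iic (a : ℝ)) *
          P.real ((fun s' => h s + q s') ⁻¹' Set.Iic (b : ℝ)) := by
      refine ae_all_iff.mpr fun a => ae_all_iff.mpr fun b => ?_
      filter_upwards [H _ _ (measurableSet_Iic (a := (a : ℝ))) (measurableSet_Iic (a := (b : ℝ))),
        key _ _ (measurableSet_Iic (a := (a : ℝ))) (measurableSet_Iic (a := (b : ℝ))),
        keyA _ (measurableSet_Iic (a := (a : ℝ))), keyB _ (measurableSet_Iic (a := (b : ℝ)))]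
        with s h1 h2 h3 h4
      rw [← h2, h1, h3, h4]
    obtain ⟨s, hs⟩ := hae.exists
    have hi : IndepFun (fun s' => g s + r s') (fun s' => h s + q s') P := by
      refine indepFun_of_measure_Iic_rat (by fun_prop) (by fun_prop) fun a b => ?_
      have := hs a b
      simp only [Measure.real, ← ENNReal.toReal_mul] at this
      exact (ENNReal.toReal_eq_toReal_iff' (measure_ne_top _ _)
        (ENNReal.mul_ne_top (measure_ne_top _ _) (measure_ne_top _ _))).mp this
    -- For the chosen `s`, `g s` and `h s` are constants, and translations preserve independence.
    have := hi.comp (φ := fun x => x - g s) (ψ := fun x => x - h s) (by fun_prop) (by fun_prop)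
    simpa [Function.comp_def] using this
  · intro hi A B hA hB
    filter_upwards [key A B hA hB, keyA A hA, keyB B hB] with s h1 h2 h3
    rw [h1, h2, h3]
    have := (hi.comp (φ := fun x => g s + x) (ψ := fun x => h s + x)
      (by fun_prop) (by fun_prop)).measure_inter_preimage_eq_mul A B hA hB
    simp only [Measure.real, ← ENNReal.toReal_mul]
    exact congrArg ENNReal.toReal this

end Freezing

/-! ### Residuals of the Gaussian process -/

section Residuals

variable {U S : Type*} {mS : MeasurableSpace S} {P : Measure S} {X : U → S → ℝ}

lemma ProbabilityTheory.HasGaussianLaw.sub_const {f : S → ℝ} (hf : HasGaussianLaw f P) (c : ℝ) :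
    HasGaussianLaw (fun s => f s - c) P := by
  have := hf.isGaussian_map
  refine ⟨?_⟩
  have h : P.map (fun s => f s - c) = (P.map f).map (fun x => x + -c) := by
    rw [AEMeasurable.map_map_of_aemeasurable (by fun_prop) hf.aemeasurable]
    rfl
  rw [h]
  infer_instance

variable [IsProbabilityMeasure P]

lemma covariance_eq_inner_of_integral_eq_zero {f g : S → ℝ} {F G : Lp ℝ 2 P} (hf : f =ᵐ[P] F)
    (hg : g =ᵐ[P] G) (h : ∫ s, G s ∂P = 0) : cov[f, g; P] = ⟪F, G⟫_ℝ := by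
  rw [covariance_eq_sub ((memLp_congr_ae hf).mpr (Lp.memLp F))
    ((memLp_congr_ae hg).mpr (Lp.memLp G)), integral_congr_ae hg, h, mul_zero, sub_zero,
    ← L2.integral_mul_eq_inner]
  refine integral_congr_ae ?_
  filter_upwards [hf, hg] with s h1 h2
  simp [h1, h2]

/-- The class in `L²` of the centred variable `X_u - E X_u`. -/
noncomputable def centeredClass (hX : IsGaussianProcess X P) (u : U) : Lp ℝ 2 P :=
  MemLp.toLp (fun s => X u s - ∫ s', X u s' ∂P)
    ((hX.hasGaussianLaw_eval u).memLp_two.sub (memLp_const _))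

lemma coeFn_centeredClass (hX : IsGaussianProcess X P) (u : U) :
    centeredClass hX u =ᵐ[P] fun s => X u s - ∫ s', X u s' ∂P :=
  MemLp.coeFn_toLp _

lemma inner_centeredClass (hX : IsGaussianProcess X P) (u v : U) :
    ⟪centeredClass hX u, centeredClass hX v⟫_ℝ = covKernel X P hX u v := by
  rw [← L2.integral_mul_eq_inner]
  refine integral_congr_ae ?_
  filter_upwards [coeFn_centeredClass hX u, coeFn_centeredClass hX v] with s h1 h2
  rw [h1, h2]

lemma integral_centeredClass (hX : IsGaussianProcess X P) (u : U) :
    ∫ s, centeredClass hX u s ∂P = 0 := by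
  rw [integral_congr_ae (coeFn_centeredClass hX u),
    integral_sub (hX.hasGaussianLaw_eval u).integrable (integrable_const _)]
  simp

lemma hasGaussianLaw_of_mem_closure_span (hX : IsGaussianProcess X P) {f : Lp ℝ 2 P}
    (hf : f ∈ (Submodule.span ℝ (Set.range (centeredClass hX))).topologicalClosure) :
    HasGaussianLaw f P := by
  refine closure_minimal (s := (Submodule.span ℝ (Set.range (centeredClass hX)) : Set (Lp ℝ 2 P)))
    (fun g hg => ?_) isClosed_hasGaussianLaw hf
  obtain ⟨c, rfl⟩ := (Finsupp.mem_span_range_iff_exists_finsupp).mp hg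
  have h := HasGaussianLaw.sub_const ((hX.smul c).hasGaussianLaw_fun_sum (I := c.support))
    (∑ u ∈ c.support, c u * ∫ s, X u s ∂P)
  refine h.congr ?_
  have h1 : ∀ᵐ s ∂P, ∀ u ∈ c.support, (c u • centeredClass hX u : Lp ℝ 2 P) s =
      c u * (X u s - ∫ s', X u s' ∂P) := by
    refine (ae_ball_iff c.support.countable_toSet).mpr fun u _ => ?_
    filter_upwards [Lp.coeFn_smul (c u) (centeredClass hX u), coeFn_centeredClass hX u]
      with s h1 h2
    rw [h1, Pi.smul_apply, h2, smul_eq_mul]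
  filter_upwards [h1, Lp.coeFn_finsetSum c.support (fun u => c u • centeredClass hX u)] with s h1 h2
  rw [Finsupp.sum, h2, Finset.sum_apply, ← Finset.sum_sub_distrib]
  refine Finset.sum_congr rfl fun u hu => ?_
  rw [h1 u hu, smul_eq_mul, mul_sub]

lemma sigmaOn_le (hXm : ∀ u, Measurable (X u)) (W : Set U) : sigmaOn X W ≤ mS :=
  (measurable_pi_lambda _ fun w : W => hXm w).comap_le

lemma measurable_sigmaOn (W : Set U) (w : W) : Measurable[sigmaOn X W] (X w) :=
  (measurable_pi_apply w).comp (comap_measurable fun s (w : W) => X w s)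

/-- A Gaussian process splits into a part measurable with respect to `X_W` and residuals
independent of `X_W`, whose covariance is `K(u, v) - ⟨K(u, ·), K(·, v)⟩`. -/
lemma exists_add_indep_residual (hXm : ∀ u, Measurable (X u)) (hX : IsGaussianProcess X P)
    (W : Set U) :
    ∃ g R : U → S → ℝ, (∀ u, Measurable[sigmaOn X W] (g u)) ∧ (∀ u, Measurable (R u)) ∧
      (∀ u, X u = fun s => g u s + R u s) ∧
      Indep (sigmaOn X W) (MeasurableSpace.comap (fun s u => R u s) inferInstance) P ∧
      IsGaussianProcess R P ∧
      ∀ u v, cov[R u, R v; P] = covKernel X P hX u v -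
        ⟪(covKernel X P hX).sectionOn W u, (covKernel X P hX).sectionOn W v⟫_ℝ := by
  have hm := sigmaOn_le hXm W
  set Y := centeredClass hX with hY
  obtain ⟨p, hp, horth, hinner⟩ :=
    (covKernel X P hX).exists_residual Y (inner_centeredClass hX) W
  have hpm : ∀ u, AEStronglyMeasurable[sigmaOn X W] (p u) P := fun u => by
    refine mem_lpMeas_iff_aestronglyMeasurable.mp
      (hp (lpMeas ℝ ℝ (sigmaOn X W) 2 P) (isClosed_aestronglyMeasurable hm) (fun w hw => ?_) u)
    refine mem_lpMeas_iff_aestronglyMeasurable.mpr ?_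
    refine AEStronglyMeasurable.congr ?_ (coeFn_centeredClass hX w).symm
    exact ((measurable_sigmaOn W ⟨w, hw⟩).sub_const _).stronglyMeasurable.aestronglyMeasurable
  have hpint : ∀ u, ∫ s, (Y u - p u : Lp ℝ 2 P) s ∂P = 0 := fun u => by
    -- Having mean zero is orthogonality to the constants, a closed condition that passes to the
    -- projection.
    have h : p u ∈ (Submodule.span ℝ {Lp.const 2 P (1 : ℝ)})ᗮ :=
      hp _ (Submodule.isClosed_orthogonal _) (fun w _ => by
        rw [Submodule.mem_orthogonal_singleton_iff_inner_right, ← integral_eq_inner_const]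
        exact integral_centeredClass hX w) u
    rw [Submodule.mem_orthogonal_singleton_iff_inner_right] at h
    rw [integral_eq_inner_const, inner_sub_right, h, ← integral_eq_inner_const,
      integral_centeredClass, sub_zero]
  set M := (Submodule.span ℝ (Set.range Y)).topologicalClosure with hMdef
  have hYM : ∀ u, Y u ∈ M := fun u =>
    Submodule.le_topologicalClosure _ (Submodule.subset_span ⟨u, rfl⟩)
  have hpM : ∀ u, p u ∈ M := hp M (Submodule.isClosed_topologicalClosure _) fun w _ => hYM w
  -- A genuinely `X_W`-measurable version of the projection; defining `R` by subtraction makes `X =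
  -- g + R` hold everywhere, not just almost surely.
  let g : U → S → ℝ := fun u s => (hpm u).mk _ s + ∫ s', X u s' ∂P
  let R : U → S → ℝ := fun u s => X u s - g u s
  have hg : ∀ u, Measurable[sigmaOn X W] (g u) := fun u =>
    (hpm u).stronglyMeasurable_mk.measurable.add_const _
  have hR : ∀ u, Measurable (R u) := fun u => (hXm u).sub ((hg u).mono hm le_rfl)
  have hRY : ∀ u, R u =ᵐ[P] (Y u - p u : Lp ℝ 2 P) := fun u => by
    filter_upwards [Lp.coeFn_sub (Y u) (p u), coeFn_centeredClass hX u, (hpm u).ae_eq_mk]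
      with s h1 h2 h3
    rw [h1, Pi.sub_apply, h3, h2]
    simp only [R, g]
    ring
  -- Vanishing covariance yields independence only for a jointly Gaussian family, so the variables
  -- on `W` and the residuals form one process.
  have hgauss : IsGaussianProcess
      (Sum.elim (fun (w : W) s => X w s - ∫ s', X w s' ∂P) R) P := by
    refine (isGaussianProcess_of_forall_mem (fun f => hasGaussianLaw_of_mem_closure_span hX)
      (Sum.elim (fun w : W => Y w) fun u => Y u - p u) ?_).congr ?_
    · rintro (w | u)
      · exact hYM w
      · exact M.sub_mem (hYM u) (hpM u)
    · rintro (w | u)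
      · exact coeFn_centeredClass hX w
      · exact (hRY u).symm
  have hindep : IndepFun (fun s (w : W) => X w s - ∫ s', X w s' ∂P) (fun s u => R u s) P := by
    refine hgauss.indepFun_of_covariance_eq_zero
      (fun w => ((hXm w).sub_const _).aemeasurable) (fun u => (hR u).aemeasurable) fun w u => ?_
    rw [covariance_eq_inner_of_integral_eq_zero (coeFn_centeredClass hX w).symm (hRY u) (hpint u),
      real_inner_comm]
    exact horth u w w.2
  refine ⟨g, R, hg, hR, fun u => by funext s; simp [R], ?_, ?_, fun u v => ?_⟩
  · rw [← IndepFun_iff_Indep]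
    have := hindep.comp (φ := fun (x : W → ℝ) (w : W) => x w + ∫ s', X w s' ∂P) (ψ := id)
      (by fun_prop) measurable_id
    simpa [Function.comp_def] using this
  · exact hgauss.comp_right Sum.inr
  · rw [covariance_eq_inner_of_integral_eq_zero (hRY u) (hRY v) (hpint v), hinner]

lemma condIndepGiven_iff_separationEquation (hXm : ∀ u, Measurable (X u))
    (hX : IsGaussianProcess X P) (W : Set U) (u v : U) :
    CondIndepGiven (sigmaOn X W) (X u) (X v) P ↔
      SeparationEquation (covKernel X P hX) W u v := by
  obtain ⟨g, R, hg, hR, hXgR, hind, hRg, hcov⟩ := exists_add_indep_residual hXm hX W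
  rw [hXgR u, hXgR v]
  have hle : MeasurableSpace.comap (fun s => (R u s, R v s)) inferInstance ≤
      MeasurableSpace.comap (fun s u => R u s) inferInstance := by
    refine Measurable.comap_le ?_
    exact (show Measurable fun x : U → ℝ => (x u, x v) by fun_prop).comp (comap_measurable _)
  rw [condIndepGiven_add_iff (sigmaOn_le hXm W) (hg u) (hg v) (hR u) (hR v)
    (indep_of_indep_of_le_right hind hle), SeparationEquation, ← sub_eq_zero, ← hcov]
  exact ⟨fun h => h.covariance_eq_zero (hRg.hasGaussianLaw_eval u).memLp_two
    (hRg.hasGaussianLaw_eval v).memLp_two,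
    fun h => hRg.hasGaussianLaw_prodMk.indepFun_of_covariance_eq_zero h⟩

end Residuals

theorem mainTheorem1 {U S : Type*} {mS : MeasurableSpace S} (P : Measure S)
    [IsProbabilityMeasure P] (X : U → S → ℝ) (hXm : ∀ u, Measurable (X u))
    (hX : IsGaussianProcess X P) (Ω : EdgeGraph U) :
    GlobalMarkov X P Ω ↔
      ∀ (u v : U) (W : Set U), Ω.Separates W u v →
        SeparationEquation (covKernel X P hX) W u v :=
  forall₃_congr fun u v W => imp_congr_right fun _ =>
    condIndepGiven_iff_separationEquation hXm hX W u v
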